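/- Let $\tau$ be a relational vocabulary, all of whose relation symbols $R$ have positive (finite) arity $\tau(R)\ge 1$. Formulas of Łukasiewicz predicate logic over $\tau$ are built from atomic formulas $R(x_{i_1},\dots,x_{i_{\tau(R)}})$ and identities $x_i\approx x_j$ by the connectives $\wedge,\vee,\rightarrow,\neg$ and the quantifiers $\forall,\exists$. A $[0,1]$-valued $\tau$-structure $\mathfrak M$ with domain $M$ consists of maps $R^{\mathfrak M}:M^{\tau(R)}\to[0,1]$ for $R\in\tau$. In $\mathfrak M$, the identity $\approx$ is crisp (value $1$ on equal elements and $0$ on distinct ones), $\wedge,\vee$ are interpreted as $\min,\max$, $\neg x=1-x$, $x\rightarrow y=\min(1,1-x+y)$, and $\forall,\exists$ as infimum and supremum over $M$; $\varphi^{\mathfrak M}\in[0,1]$ denotes the value of a sentence $\varphi$. For each $R\in\tau$ let $p_R$ be a Borel probability measure on $[0,1]$ that gives positive measure to every interval of $[0,1]$ with more than one point. Let $\rho_n$ be the product measure on $\prod_{R\in\tau}[0,1]^{[n]^{\tau(R)}}$, the space of $[0,1]$-valued $\tau$-structures with domain $[n]=\{1,\dots,n\}$, under which the values $R^{\mathfrak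 M}(i_1,\dots,i_{\tau(R)})$ are independent with law $p_R$. Put $\mu_n(\varphi\in V)=\rho_n\{\mathfrak M:\varphi^{\mathfrak M}\in V\}$ for Borel $V\subseteq[0,1]$. Then for every sentence $\varphi$ there is a unique $a\in[0,1]$ such that $$\lim_{n\to\infty}\mu_n(\varphi\in V)=1\quad\text{for every (relatively) open interval } V\subseteq[0,1] \text{ containing } a.$$ Equivalently (each $a\in[0,1]$ has the property above if and only if it has the following one), there is a unique $a\in[0,1]$ such that $$\lim_{n\to\infty}\mu_n(|\varphi-a|<\varepsilon)=1\quad\text{for every }\varepsilon>0.$$ -/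

import Mathlib

open MeasureTheory Filter Topology
open scoped unitInterval

/-- An atomic event over the domain `M`: a relation symbol `R` together with a tuple of
`ar R` elements of `M`. -/
abbrev LukAtom {τ : Type*} (ar : τ → ℕ) (M : Type*) : Type _ :=
  Σ R : τ, (Fin (ar R) → M)

/-- A `[0,1]`-valued structure with domain `M` for the relational vocabulary `τ` with arities `ar`:
it gives each `R(i₁, …, iₖ)` a truth value. This is `∏_R [0,1]^(M^(ar R))`. -/
abbrev LukStructure {τ : Type*} (ar : τ → ℕ) (M : Type*) : Type _ :=
  LukAtom ar M → I

/-- Formulas of Łukasiewicz predicate logic (with identity) with free variables among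
`x₀, …, x_{k-1}`. A quantifier binds the last variable of its scope. -/
inductive LukFormula {τ : Type*} (ar : τ → ℕ) : ℕ → Type _
  | rel {k : ℕ} (R : τ) (t : Fin (ar R) → Fin k) : LukFormula ar k
  | eq {k : ℕ} (i j : Fin k) : LukFormula ar k
  | and {k : ℕ} (φ ψ : LukFormula ar k) : LukFormula ar k
  | or {k : ℕ} (φ ψ : LukFormula ar k) : LukFormula ar k
  | imp {k : ℕ} (φ ψ : LukFormula ar k) : LukFormula ar k
  | neg {k : ℕ} (φ : LukFormula ar k) : LukFormula ar k
  | all {k : ℕ} (φ : LukFormula ar (k + 1)) : LukFormula ar k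
  | ex {k : ℕ} (φ : LukFormula ar (k + 1)) : LukFormula ar k

/-- Sentences: formulas without free variables. -/
abbrev LukSentence {τ : Type*} (ar : τ → ℕ) : Type _ := LukFormula ar 0

/-- Łukasiewicz implication `x → y = min (1, 1 - x + y)` on `[0,1]`. -/
noncomputable def lukImp (x y : I) : I :=
  ⟨min 1 (1 - (x : ℝ) + y),
    le_min zero_le_one (by linarith [unitInterval.le_one x, unitInterval.nonneg y]),
    min_le_left _ _⟩

open Classical in
/-- The truth value of a formula in a structure under an assignment `v` of its free variables.
Conjunction and disjunction are `min` and `max`, negation is `1 - x`, identity is crisp, and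
quantifiers are infima and suprema in `[0,1]`. -/
noncomputable def LukFormula.eval {τ : Type*} {ar : τ → ℕ} {M : Type*}
    (S : LukStructure ar M) : {k : ℕ} → LukFormula ar k → (Fin k → M) → I
  | _, .rel R t, v => S ⟨R, fun j => v (t j)⟩
  | _, .eq i j, v => if v i = v j then 1 else 0
  | _, .and φ ψ, v => φ.eval S v ⊓ ψ.eval S v
  | _, .or φ ψ, v => φ.eval S v ⊔ ψ.eval S v
  | _, .imp φ ψ, v => lukImp (φ.eval S v) (ψ.eval S v)
  | _, .neg φ, v => unitInterval.symm (φ.eval S v)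
  | _, .all φ, v => ⨅ m : M, φ.eval S (Fin.snoc v m)
  | _, .ex φ, v => ⨆ m : M, φ.eval S (Fin.snoc v m)

/-- The truth value of a sentence in a structure. -/
noncomputable def LukSentence.value {τ : Type*} {ar : τ → ℕ} {M : Type*}
    (φ : LukSentence ar) (S : LukStructure ar M) : I :=
  LukFormula.eval S φ Fin.elim0

/-- The probability measure `ρₙ` on structures with domain `[n]`: the truth values of the atomic
events are independent, and that of `R(i₁, …, iₖ)` has law `p R`. -/
noncomputable def lukModelMeasure {τ : Type*} (ar : τ → ℕ) (p : τ → Measure I)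
    [∀ R, IsProbabilityMeasure (p R)] (n : ℕ) : Measure (LukStructure ar (Fin n)) :=
  Measure.infinitePi fun a : LukAtom ar (Fin n) => p a.1

/-- `μₙ(φ ∈ V)`, the probability that `φ` takes a value in `V` in a random structure with
domain `[n]`. -/
noncomputable def lukProb {τ : Type*} {ar : τ → ℕ} (p : τ → Measure I)
    [∀ R, IsProbabilityMeasure (p R)] (n : ℕ) (φ : LukSentence ar) (V : Set I) : ENNReal :=
  lukModelMeasure ar p n {S | φ.value S ∈ V}

theorem measurable_lukImp : Measurable fun q : I × I => lukImp q.1 q.2 := by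
  unfold lukImp
  exact Measurable.subtype_mk (by fun_prop)

/-- Truth values are measurable functions of the structure, so `μₙ(φ ∈ V)` is the probability of a
measurable event whenever `V` is a Borel set. -/
theorem LukFormula.measurable_eval {τ : Type*} {ar : τ → ℕ} {n k : ℕ} (φ : LukFormula ar k)
    (v : Fin k → Fin n) : Measurable fun S : LukStructure ar (Fin n) => φ.eval S v := by
  induction φ with
  | rel R t => exact measurable_pi_apply _
  | eq i j => exact measurable_const
  | and φ ψ h₁ h₂ => exact (h₁ v).inf (h₂ v)
  | or φ ψ h₁ h₂ => exact (h₁ v).sup (h₂ v)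
  | imp φ ψ h₁ h₂ => exact measurable_lukImp.comp ((h₁ v).prodMk (h₂ v))
  | neg φ h => exact unitInterval.continuous_symm.measurable.comp (h v)
  | all φ h => exact Measurable.iInf fun m => h _
  | ex φ h => exact Measurable.iSup fun m => h _

/-!
Fix an injective tuple `w` of `j` elements of `[n]` and a ball of prescriptions for the atomic
events that a new element creates. The `n - j` possible new elements involve disjoint sets of atomic
events, and by full support each of them lands in the ball with the same probability `c > 0`, so
some tuple has no such new element with probability at most `n ^ j * (1 - c) ^ (n - j)`, which tends
to `0`. Since the prescriptions form a compact space, finitely many balls suffice: asymptotically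
almost surely all extension axioms hold up to `δ`. In two such structures Duplicator keeps atomic
truth values within `δ` of each other in the back-and-forth game, so the values of `φ` differ by at
most a constant times `δ`. Hence the value of `φ` is Cauchy along the filter of asymptotically
almost sure events, and `a` is its limit.
-/

section AsymptoticallyAlmostSurely

variable {ι : Type*} {Ω : ι → Type*} [∀ i, MeasurableSpace (Ω i)]

/-- The filter of events that hold asymptotically almost surely along `l` for a family of measure
spaces `(Ω i, μ i)`. It is defined by complements, so that no measurability is needed. -/
def aasFilter (μ : ∀ i, Measure (Ω i)) (l : Filter ι) : Filter (Σ i, Ω i) :=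
  comk (fun A => Tendsto (fun i => μ i (Sigma.mk i ⁻¹' A)) l (𝓝 0))
    (by simp only [Set.preimage_empty, measure_empty, tendsto_const_nhds])
    (fun _ hB _ hAB => tendsto_of_tendsto_of_tendsto_of_le_of_le tendsto_const_nhds hB
      (fun _ => zero_le) fun _ => measure_mono (Set.preimage_mono hAB))
    (fun _ hA _ hB => tendsto_of_tendsto_of_tendsto_of_le_of_le tendsto_const_nhds
      (add_zero (0 : ENNReal) ▸ hA.add hB) (fun _ => zero_le) fun _ => measure_union_le _ _)

variable {μ : ∀ i, Measure (Ω i)} {l : Filter ι}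

theorem eventually_aasFilter_iff {P : (Σ i, Ω i) → Prop} :
    (∀ᶠ ω in aasFilter μ l, P ω) ↔ Tendsto (fun i => μ i {x | ¬ P ⟨i, x⟩}) l (𝓝 0) :=
  Iff.rfl

variable [∀ i, IsProbabilityMeasure (μ i)]

instance aasFilter.neBot [l.NeBot] : (aasFilter μ l).NeBot := by
  refine ⟨fun h => zero_ne_one' ENNReal ?_⟩
  have hlim : Tendsto (fun i => μ i {_x : Ω i | ¬ False}) l (𝓝 0) :=
    eventually_aasFilter_iff.1 (eventually_false_iff_eq_bot.2 h)
  simp only [not_false_eq_true, Set.ofPred_true, measure_univ] at hlim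
  exact tendsto_nhds_unique hlim tendsto_const_nhds

theorem eventually_aasFilter_iff_tendsto_one {P : (Σ i, Ω i) → Prop}
    (hP : ∀ i, MeasurableSet {x : Ω i | P ⟨i, x⟩}) :
    (∀ᶠ ω in aasFilter μ l, P ω) ↔ Tendsto (fun i => μ i {x | P ⟨i, x⟩}) l (𝓝 1) := by
  have hcompl (i : ι) : μ i {x | ¬ P ⟨i, x⟩} = 1 - μ i {x | P ⟨i, x⟩} :=
    prob_compl_eq_one_sub (hP i)
  have hcompl' (i : ι) : μ i {x | P ⟨i, x⟩} = 1 - μ i {x | ¬ P ⟨i, x⟩} := by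
    rw [hcompl, ENNReal.sub_sub_cancel ENNReal.one_ne_top prob_le_one]
  have one_sub {u : ι → ENNReal} {a : ENNReal} (hu : Tendsto u l (𝓝 a)) :
      Tendsto (fun i => 1 - u i) l (𝓝 (1 - a)) :=
    ENNReal.Tendsto.sub tendsto_const_nhds hu (.inl ENNReal.one_ne_top)
  rw [eventually_aasFilter_iff]
  constructor <;> intro h
  · simpa only [hcompl', tsub_zero] using one_sub h
  · simpa only [hcompl, tsub_self] using one_sub h

end AsymptoticallyAlmostSurely

section UnitInterval

theorem dist_inf_inf_le_add (a b c d : I) : dist (a ⊓ b) (c ⊓ d) ≤ dist a c + dist b d :=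
  (abs_min_sub_min_le_max (a : ℝ) b c d).trans (max_le_add_of_nonneg (abs_nonneg _) (abs_nonneg _))

theorem dist_sup_sup_le_add (a b c d : I) : dist (a ⊔ b) (c ⊔ d) ≤ dist a c + dist b d :=
  (abs_max_sub_max_le_max (a : ℝ) b c d).trans (max_le_add_of_nonneg (abs_nonneg _) (abs_nonneg _))

theorem dist_lukImp_lukImp_le_add (a b c d : I) :
    dist (lukImp a b) (lukImp c d) ≤ dist a c + dist b d := by
  calc dist (lukImp a b) (lukImp c d)
      ≤ max |(1 : ℝ) - 1| |(1 - (a : ℝ) + b) - (1 - c + d)| := abs_min_sub_min_le_max _ _ _ _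
    _ = |((b : ℝ) - d) - (a - c)| := by
        rw [sub_self, abs_zero, max_eq_right (abs_nonneg _)]
        ring_nf
    _ ≤ |(b : ℝ) - d| + |(a : ℝ) - c| := abs_sub _ _
    _ = dist a c + dist b d := add_comm _ _

theorem dist_unitInterval_symm_symm (a b : I) :
    dist (unitInterval.symm a) (unitInterval.symm b) = dist a b :=
  dist_sub_left (1 : ℝ) a b

variable {ι κ : Type*} {f : ι → I} {g : κ → I} {c : ℝ}

theorem coe_iSup_le_coe_iSup_add (hc : 0 ≤ c) (h : ∀ i, ∃ j, (f i : ℝ) ≤ g j + c) :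
    ((⨆ i, f i : I) : ℝ) ≤ (⨆ j, g j : I) + c := by
  obtain hlarge | hsmall := le_total 1 (((⨆ j, g j : I) : ℝ) + c)
  · exact (unitInterval.le_one _).trans hlarge
  · refine (iSup_le fun i => ?_ :
      ⨆ i, f i ≤ ⟨(⨆ j, g j : I) + c, add_nonneg (unitInterval.nonneg _) hc, hsmall⟩)
    obtain ⟨j, hij⟩ := h i
    have hj : (g j : ℝ) ≤ (⨆ j, g j : I) := le_iSup g j
    exact hij.trans (add_le_add_left hj c)

theorem coe_iInf_le_coe_iInf_add (hc : 0 ≤ c) (h : ∀ j, ∃ i, (f i : ℝ) ≤ g j + c) :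
    ((⨅ i, f i : I) : ℝ) ≤ (⨅ j, g j : I) + c := by
  rw [← sub_le_iff_le_add]
  obtain hneg | hnonneg := le_total (((⨅ i, f i : I) : ℝ) - c) 0
  · exact hneg.trans (unitInterval.nonneg _)
  · refine (le_iInf fun j => ?_ :
      ⟨(⨅ i, f i : I) - c, hnonneg, (sub_le_self _ hc).trans (unitInterval.le_one _)⟩ ≤ ⨅ j, g j)
    obtain ⟨i, hij⟩ := h j
    have hi : ((⨅ i, f i : I) : ℝ) ≤ f i := iInf_le f i
    exact sub_le_iff_le_add.2 (hi.trans hij)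

theorem coe_le_add_of_dist_le {x y : I} (h : dist x y ≤ c) : (x : ℝ) ≤ y + c :=
  sub_le_iff_le_add'.1 ((le_abs_self _).trans h)

theorem dist_iSup_iSup_le (hc : 0 ≤ c) (hfg : ∀ i, ∃ j, dist (f i) (g j) ≤ c)
    (hgf : ∀ j, ∃ i, dist (f i) (g j) ≤ c) : dist (⨆ i, f i) (⨆ j, g j) ≤ c := by
  refine abs_sub_le_iff.2 ⟨sub_le_iff_le_add'.2 ?_, sub_le_iff_le_add'.2 ?_⟩
  · exact coe_iSup_le_coe_iSup_add hc fun i => (hfg i).imp fun _ => coe_le_add_of_dist_le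
  · exact coe_iSup_le_coe_iSup_add hc fun j =>
      (hgf j).imp fun _ h => coe_le_add_of_dist_le (dist_comm (α := I) _ _ ▸ h)

theorem dist_iInf_iInf_le (hc : 0 ≤ c) (hfg : ∀ i, ∃ j, dist (f i) (g j) ≤ c)
    (hgf : ∀ j, ∃ i, dist (f i) (g j) ≤ c) : dist (⨅ i, f i) (⨅ j, g j) ≤ c := by
  refine abs_sub_le_iff.2 ⟨sub_le_iff_le_add'.2 ?_, sub_le_iff_le_add'.2 ?_⟩
  · exact coe_iInf_le_coe_iInf_add hc fun j => (hgf j).imp fun _ => coe_le_add_of_dist_le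
  · exact coe_iInf_le_coe_iInf_add hc fun i =>
      (hfg i).imp fun _ h => coe_le_add_of_dist_le (dist_comm (α := I) _ _ ▸ h)

end UnitInterval

section BackAndForth

variable {τ : Type*} {ar : τ → ℕ}

namespace LukFormula

/-- The relation symbols occurring in a formula. -/
def rels : {k : ℕ} → LukFormula ar k → Set τ
  | _, .rel R _ => {R}
  | _, .eq _ _ => ∅
  | _, .and φ ψ => φ.rels ∪ ψ.rels
  | _, .or φ ψ => φ.rels ∪ ψ.rels
  | _, .imp φ ψ => φ.rels ∪ ψ.rels
  | _, .neg φ => φ.rels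
  | _, .all φ => φ.rels
  | _, .ex φ => φ.rels

/-- The quantifier depth of a formula: the number of rounds of the back-and-forth game that decide
its truth value. -/
def depth : {k : ℕ} → LukFormula ar k → ℕ
  | _, .rel _ _ => 0
  | _, .eq _ _ => 0
  | _, .and φ ψ => max φ.depth ψ.depth
  | _, .or φ ψ => max φ.depth ψ.depth
  | _, .imp φ ψ => max φ.depth ψ.depth
  | _, .neg φ => φ.depth
  | _, .all φ => φ.depth + 1
  | _, .ex φ => φ.depth + 1

/-- The number of occurrences of relation symbols in a formula. It is a Lipschitz constant of the
truth value as a function of the truth values of the atomic events. -/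
def relCount : {k : ℕ} → LukFormula ar k → ℕ
  | _, .rel _ _ => 1
  | _, .eq _ _ => 0
  | _, .and φ ψ => φ.relCount + ψ.relCount
  | _, .or φ ψ => φ.relCount + ψ.relCount
  | _, .imp φ ψ => φ.relCount + ψ.relCount
  | _, .neg φ => φ.relCount
  | _, .all φ => φ.relCount
  | _, .ex φ => φ.relCount

theorem finite_rels {k : ℕ} (φ : LukFormula ar k) : φ.rels.Finite := by
  induction φ with
  | rel R => exact Set.finite_singleton R
  | eq => exact Set.finite_empty
  | and _ _ hφ hψ | or _ _ hφ hψ | imp _ _ hφ hψ => exact hφ.union hψ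
  | neg _ hφ | all _ hφ | ex _ hφ => exact hφ

end LukFormula

variable {M N : Type*}

/-- The atomic event obtained by renaming the elements of the domain along `f`. -/
def LukAtom.map (f : M → N) (a : LukAtom ar M) : LukAtom ar N :=
  ⟨a.1, f ∘ a.2⟩

/-- The atomic events over `j + 1` elements that involve the last element and a relation symbol
of `F`. -/
def LukAtom.newAtoms (ar : τ → ℕ) (F : Set τ) (j : ℕ) : Set (LukAtom ar (Fin (j + 1))) :=
  {a | a.1 ∈ F ∧ Fin.last j ∈ Set.range a.2}

namespace LukStructure

/-- The truth values in `S` of the new atomic events that arise when the tuple `w` is extended by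
the element `m`. -/
def extensionDiagram (S : LukStructure ar M) (F : Set τ) {j : ℕ} (w : Fin j ↪ M)
    (m : {m // m ∉ Set.range w}) : LukAtom.newAtoms ar F j → I :=
  fun a => S (LukAtom.map (Fin.Embedding.snoc w m.2) a)

/-- The extension axioms up to an error `δ`: over every injective tuple of fewer than `K` elements,
each prescription of the new atomic events is realized up to `δ` by some new element. -/
def IsGeneric (S : LukStructure ar M) (F : Set τ) (K : ℕ) (δ : ℝ) : Prop :=
  ∀ j < K, ∀ (w : Fin j ↪ M) (t : LukAtom.newAtoms ar F j → I),
    ∃ m, ∀ a, dist (S.extensionDiagram F w m a) (t a) ≤ δ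

end LukStructure

/-- The partial injection `u i ↦ v i` between `S` and `T` changes the truth values of the atomic
events in `F` by at most `δ`. -/
def LukPartialIso (S : LukStructure ar M) (T : LukStructure ar N) (F : Set τ) (δ : ℝ) {j : ℕ}
    (u : Fin j ↪ M) (v : Fin j ↪ N) : Prop :=
  ∀ a : LukAtom ar (Fin j), a.1 ∈ F → dist (S (LukAtom.map u a)) (T (LukAtom.map v a)) ≤ δ

namespace LukPartialIso

variable {S : LukStructure ar M} {T : LukStructure ar N} {F : Set τ} {δ : ℝ} {j k K : ℕ}
  {u : Fin j ↪ M} {v : Fin j ↪ N}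

theorem symm (h : LukPartialIso S T F δ u v) : LukPartialIso T S F δ v u :=
  fun a ha => (dist_comm (α := I) _ _).trans_le (h a ha)

theorem exists_extension (h : LukPartialIso S T F δ u v) (hT : T.IsGeneric F K δ) (hj : j < K)
    (m : {m // m ∉ Set.range u}) :
    ∃ m' : {m' // m' ∉ Set.range v},
      LukPartialIso S T F δ (Fin.Embedding.snoc u m.2) (Fin.Embedding.snoc v m'.2) := by
  obtain ⟨m', hm'⟩ := hT j hj v (S.extensionDiagram F u m)
  refine ⟨m', fun ⟨R, x⟩ hR => ?_⟩
  by_cases hx : Fin.last j ∈ Set.range x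
  · exact (dist_comm (α := I) _ _).trans_le (hm' ⟨⟨R, x⟩, hR, hx⟩)
  · have hold (i) : ∃ i' : Fin j, i'.castSucc = x i :=
      Fin.exists_castSucc_eq.2 fun hi => hx ⟨i, hi⟩
    choose y hy using hold
    obtain rfl : Fin.castSucc ∘ y = x := funext hy
    simpa only [LukAtom.map, Function.comp_def, Fin.Embedding.snoc_castSucc] using h ⟨R, y⟩ hR

theorem exists_snoc (h : LukPartialIso S T F δ u v) (hT : T.IsGeneric F K δ) (hj : j < K)
    (s : Fin k → Fin j) (m : M) :
    ∃ (m' : N) (j' : ℕ) (u' : Fin j' ↪ M) (v' : Fin j' ↪ N) (s' : Fin (k + 1) → Fin j'),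
      j' ≤ j + 1 ∧ LukPartialIso S T F δ u' v' ∧
        Fin.snoc (u ∘ s) m = u' ∘ s' ∧ Fin.snoc (v ∘ s) m' = v' ∘ s' := by
  by_cases hm : m ∈ Set.range u
  · obtain ⟨i, rfl⟩ := hm
    exact ⟨v i, j, u, v, Fin.snoc s i, j.le_succ, h, (Fin.comp_snoc _ _ _).symm,
      (Fin.comp_snoc _ _ _).symm⟩
  · obtain ⟨m', h'⟩ := h.exists_extension hT hj ⟨m, hm⟩
    refine ⟨m', j + 1, _, _, Fin.snoc (Fin.castSucc ∘ s) (Fin.last j), le_rfl, h', ?_, ?_⟩ <;>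
    simp only [Fin.comp_snoc, ← Function.comp_assoc, Fin.Embedding.snoc_last] <;>
    simp only [Function.comp_def, Fin.Embedding.snoc_castSucc]

theorem dist_eval_le (hδ : 0 ≤ δ) (hS : S.IsGeneric F K δ) (hT : T.IsGeneric F K δ)
    (φ : LukFormula ar k) (hF : φ.rels ⊆ F) (hK : j + φ.depth ≤ K)
    (h : LukPartialIso S T F δ u v) (s : Fin k → Fin j) :
    dist (φ.eval S (u ∘ s)) (φ.eval T (v ∘ s)) ≤ φ.relCount * δ := by
  induction φ generalizing j with
  | rel R t =>
    simpa only [LukFormula.relCount, Nat.cast_one, one_mul] using! h ⟨R, s ∘ t⟩ (hF rfl)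
  | eq a b => simp [LukFormula.eval, LukFormula.relCount]
  | and φ ψ ihφ ihψ =>
    obtain ⟨hFφ, hFψ⟩ := Set.union_subset_iff.1 hF
    simp only [LukFormula.depth, LukFormula.relCount, Nat.cast_add, add_mul] at hK ⊢
    exact (dist_inf_inf_le_add _ _ _ _).trans
      (add_le_add (ihφ hFφ (by omega) h s) (ihψ hFψ (by omega) h s))
  | or φ ψ ihφ ihψ =>
    obtain ⟨hFφ, hFψ⟩ := Set.union_subset_iff.1 hF
    simp only [LukFormula.depth, LukFormula.relCount, Nat.cast_add, add_mul] at hK ⊢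
    exact (dist_sup_sup_le_add _ _ _ _).trans
      (add_le_add (ihφ hFφ (by omega) h s) (ihψ hFψ (by omega) h s))
  | imp φ ψ ihφ ihψ =>
    obtain ⟨hFφ, hFψ⟩ := Set.union_subset_iff.1 hF
    simp only [LukFormula.depth, LukFormula.relCount, Nat.cast_add, add_mul] at hK ⊢
    exact (dist_lukImp_lukImp_le_add _ _ _ _).trans
      (add_le_add (ihφ hFφ (by omega) h s) (ihψ hFψ (by omega) h s))
  | neg φ ih => exact (dist_unitInterval_symm_symm _ _).trans_le (ih hF hK h s)
  | all φ ih =>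
    simp only [LukFormula.depth] at hK
    refine dist_iInf_iInf_le (by positivity) (fun m => ?_) (fun m => ?_)
    · obtain ⟨m', j', u', v', s', hj', h', hu, hv⟩ := h.exists_snoc hT (by omega) s m
      exact ⟨m', hu ▸ hv ▸ ih hF (by omega) h' s'⟩
    · obtain ⟨m', j', v', u', s', hj', h', hv, hu⟩ := h.symm.exists_snoc hS (by omega) s m
      exact ⟨m', hu ▸ hv ▸ ih hF (by omega) h'.symm s'⟩
  | ex φ ih =>
    simp only [LukFormula.depth] at hK
    refine dist_iSup_iSup_le (by positivity) (fun m => ?_) (fun m => ?_)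
    · obtain ⟨m', j', u', v', s', hj', h', hu, hv⟩ := h.exists_snoc hT (by omega) s m
      exact ⟨m', hu ▸ hv ▸ ih hF (by omega) h' s'⟩
    · obtain ⟨m', j', v', u', s', hj', h', hv, hu⟩ := h.symm.exists_snoc hS (by omega) s m
      exact ⟨m', hu ▸ hv ▸ ih hF (by omega) h'.symm s'⟩

end LukPartialIso

theorem LukSentence.dist_value_le (har : ∀ R, 1 ≤ ar R) {S : LukStructure ar M}
    {T : LukStructure ar N} {δ : ℝ} (hδ : 0 ≤ δ) (φ : LukSentence ar)
    (hS : S.IsGeneric φ.rels φ.depth δ) (hT : T.IsGeneric φ.rels φ.depth δ) :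
    dist (LukSentence.value φ S) (LukSentence.value φ T) ≤ φ.relCount * δ := by
  -- An atomic event over the empty domain would need a nullary relation symbol.
  have hempty : LukPartialIso S T φ.rels δ (Function.Embedding.ofIsEmpty : Fin 0 ↪ M)
      Function.Embedding.ofIsEmpty := fun a _ => (a.2 ⟨0, har a.1⟩).elim0
  have hM : (Function.Embedding.ofIsEmpty : Fin 0 ↪ M) ∘ Fin.elim0 = Fin.elim0 :=
    Subsingleton.elim _ _
  have hN : (Function.Embedding.ofIsEmpty : Fin 0 ↪ N) ∘ Fin.elim0 = Fin.elim0 :=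
    Subsingleton.elim _ _
  simpa only [LukSentence.value, hM, hN] using
    hempty.dist_eval_le hδ hS hT φ subset_rfl (zero_add _).le Fin.elim0

end BackAndForth

section RandomStructures

theorem infinitePi_forall_notMem {ι α β X : Type*} [MeasurableSpace X] [Fintype α] [Fintype β]
    (μ : ι → Measure X) [∀ i, IsProbabilityMeasure (μ i)] (ν : β → Measure X)
    [∀ b, IsProbabilityMeasure (ν b)] {f : α × β → ι} (hf : Function.Injective f)
    (hμ : ∀ q, μ (f q) = ν q.2) {B : Set (β → X)} (hB : MeasurableSet B) :
    Measure.infinitePi μ {S | ∀ a, (fun b => S (f (a, b))) ∉ B} =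
      (1 - Measure.pi ν B) ^ Fintype.card α := by
  have hBpi : MeasurableSet (Set.univ.pi fun _ : α => Bᶜ) :=
    MeasurableSet.univ_pi fun _ => hB.compl
  have hcurry : Measurable (MeasurableEquiv.curry α β X) := (MeasurableEquiv.curry α β X).measurable
  have hset : {S : ι → X | ∀ a, (fun b => S (f (a, b))) ∉ B} =
      (fun S q => S (f q)) ⁻¹' (MeasurableEquiv.curry α β X ⁻¹' Set.univ.pi fun _ => Bᶜ) := by
    ext S
    simp only [Set.mem_preimage, Set.mem_univ_pi, Set.mem_ofPred_eq]
    rfl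
  calc Measure.infinitePi μ {S | ∀ a, (fun b => S (f (a, b))) ∉ B}
      = Measure.infinitePi (fun q : α × β => ν q.2)
          (MeasurableEquiv.curry α β X ⁻¹' Set.univ.pi fun _ => Bᶜ) := by
        rw [hset, ← Measure.map_apply (by fun_prop) (hcurry hBpi),
          Measure.map_infinitePi_infinitePi_of_inj hf]
        simp only [hμ]
    _ = Measure.pi (fun _ : α => Measure.pi ν) (Set.univ.pi fun _ => Bᶜ) := by
        rw [← Measure.map_apply hcurry hBpi, Measure.infinitePi_map_curry (fun (_ : α) b => ν b),
          Measure.infinitePi_eq_pi, Measure.infinitePi_eq_pi]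
    _ = (1 - Measure.pi ν B) ^ Fintype.card α := by
        simp only [Measure.pi_pi, prob_compl_eq_one_sub hB, Finset.prod_const, Finset.card_univ]

theorem tendsto_descFactorial_mul_pow_sub (k : ℕ) {r : ENNReal} (hr : r < 1) :
    Tendsto (fun n : ℕ => n.descFactorial k * r ^ (n - k)) atTop (𝓝 0) := by
  lift r to NNReal using (hr.trans ENNReal.one_lt_top).ne
  rw [← tendsto_add_atTop_iff_nat k]
  have hsummable : Summable fun n : ℕ => ((n + k).descFactorial k : ℝ) * (r : ℝ) ^ n :=
    summable_descFactorial_mul_geometric_of_norm_lt_one k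
      (by simpa only [NNReal.norm_eq] using mod_cast hr)
  have hlim : Tendsto (fun n : ℕ => ((n + k).descFactorial k : NNReal) * r ^ n) atTop (𝓝 0) :=
    NNReal.tendsto_coe.1 (by simpa using hsummable.tendsto_atTop_zero)
  simpa using ENNReal.tendsto_coe.2 hlim

theorem isOpenPosMeasure_of_forall_ordConnected_pos {X : Type*} [LinearOrder X]
    [TopologicalSpace X] [OrderTopology X] [PerfectSpace X] [MeasurableSpace X] {μ : Measure X}
    (hμ : ∀ J : Set X, J.OrdConnected → J.Nontrivial → 0 < μ J) : μ.IsOpenPosMeasure := by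
  refine ⟨fun U hU ⟨x, hx⟩ => ?_⟩
  obtain ⟨b, c, -, hmem, hsub⟩ := exists_Icc_mem_subset_of_mem_nhds (hU.mem_nhds hx)
  have hpos := hμ (Set.Icc b c) Set.ordConnected_Icc (infinite_of_mem_nhds x hmem).nontrivial
  exact (hpos.trans_le (measure_mono hsub)).ne'

variable {τ : Type*} {ar : τ → ℕ}

theorem LukAtom.map_injective {M N : Type*} {f : M → N} (hf : Function.Injective f) :
    Function.Injective (LukAtom.map f : LukAtom ar M → LukAtom ar N) :=
  Function.injective_id.sigma_map (β₂ := fun R => Fin (ar R) → N) fun _ => hf.comp_left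

theorem LukAtom.finite_newAtoms {F : Set τ} (hF : F.Finite) (j : ℕ) :
    (LukAtom.newAtoms ar F j).Finite :=
  (hF.biUnion fun R _ => Set.finite_range (Sigma.mk R)).subset fun a ha =>
    Set.mem_biUnion ha.1 ⟨a.2, rfl⟩

theorem LukAtom.map_snoc_injective {M : Type*} {F : Set τ} {j : ℕ} (w : Fin j ↪ M) :
    Function.Injective fun q : {m // m ∉ Set.range w} × LukAtom.newAtoms ar F j =>
      LukAtom.map (Fin.Embedding.snoc w q.1.2) q.2.1 := by
  rintro ⟨⟨m, hm⟩, a, ha⟩ ⟨⟨m', hm'⟩, a', ha'⟩ h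
  have hrange := congrArg (fun b : LukAtom ar M => Set.range b.2) h
  have hmem : m ∈ Set.range (Fin.Embedding.snoc w hm') := by
    refine Set.range_comp_subset_range a'.2 _ (hrange.subset ?_)
    obtain ⟨i, hi⟩ := ha.2
    exact ⟨i, (congrArg (Fin.Embedding.snoc w hm) hi).trans Fin.Embedding.snoc_last⟩
  obtain rfl : m = m' := ((Fin.range_snoc w m').subset hmem).resolve_right hm
  obtain rfl : a = a' := LukAtom.map_injective (Fin.Embedding.snoc w hm).injective h
  rfl

variable (p : τ → Measure I) [∀ R, IsProbabilityMeasure (p R)]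

instance lukModelMeasure.isProbabilityMeasure (n : ℕ) :
    IsProbabilityMeasure (lukModelMeasure ar p n) :=
  inferInstanceAs (IsProbabilityMeasure (Measure.infinitePi _))

theorem lukModelMeasure_forall_extensionDiagram_notMem {F : Set τ} {j n : ℕ}
    [Fintype (LukAtom.newAtoms ar F j)] (w : Fin j ↪ Fin n) {B : Set (LukAtom.newAtoms ar F j → I)}
    (hB : MeasurableSet B) :
    lukModelMeasure ar p n {S | ∀ m, S.extensionDiagram F w m ∉ B} =
      (1 - Measure.pi (fun a : LukAtom.newAtoms ar F j => p a.1.1) B) ^ (n - j) := by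
  classical
  have hcard : Fintype.card {m // m ∉ Set.range w} = n - j := by
    rw [Fintype.card_subtype_compl, Fintype.card_fin]
    congr 1
    exact (Set.card_range_of_injective w.injective).trans (Fintype.card_fin j)
  rw [← hcard]
  exact infinitePi_forall_notMem _ (fun a : LukAtom.newAtoms ar F j => p a.1.1)
    (LukAtom.map_snoc_injective w) (fun _ => rfl) hB

theorem eventually_exists_extensionDiagram_mem {F : Set τ} {j : ℕ}
    [Fintype (LukAtom.newAtoms ar F j)] {B : Set (LukAtom.newAtoms ar F j → I)}
    (hB : MeasurableSet B)
    (hpos : Measure.pi (fun a : LukAtom.newAtoms ar F j => p a.1.1) B ≠ 0) :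
    ∀ᶠ ω in aasFilter (lukModelMeasure ar p) atTop, ∀ w, ∃ m, ω.2.extensionDiagram F w m ∈ B := by
  set r := 1 - Measure.pi (fun a : LukAtom.newAtoms ar F j => p a.1.1) B with hr
  have hr1 : r < 1 := ENNReal.sub_lt_self ENNReal.one_ne_top one_ne_zero hpos
  refine eventually_aasFilter_iff.2 (tendsto_of_tendsto_of_tendsto_of_le_of_le tendsto_const_nhds
    (tendsto_descFactorial_mul_pow_sub j hr1) (fun _ => zero_le) fun n => ?_)
  calc lukModelMeasure ar p n {S | ¬ ∀ w, ∃ m, S.extensionDiagram F w m ∈ B}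
      = lukModelMeasure ar p n (⋃ w, {S | ∀ m, S.extensionDiagram F w m ∉ B}) := by
        simp only [not_forall, not_exists, Set.ofPred_exists]
    _ ≤ ∑ w, lukModelMeasure ar p n {S | ∀ m, S.extensionDiagram F w m ∉ B} :=
        measure_iUnion_fintype_le _ _
    _ = n.descFactorial j * r ^ (n - j) := by
        simp only [lukModelMeasure_forall_extensionDiagram_notMem p _ hB, Finset.sum_const,
          nsmul_eq_mul, Finset.card_univ, Fintype.card_embedding_eq, Fintype.card_fin, hr]

theorem eventually_isGeneric [∀ R, (p R).IsOpenPosMeasure] {F : Set τ} (hF : F.Finite) (K : ℕ)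
    {δ : ℝ} (hδ : 0 < δ) :
    ∀ᶠ ω in aasFilter (lukModelMeasure ar p) atTop, ω.2.IsGeneric F K δ := by
  refine (eventually_all_finite (Set.finite_lt_nat K)).2 fun j _ => ?_
  have := (LukAtom.finite_newAtoms (ar := ar) hF j).fintype
  obtain ⟨net, -, hfinite, hcover⟩ :=
    (isCompact_univ (X := LukAtom.newAtoms ar F j → I)).finite_cover_balls (half_pos hδ)
  have hrealized : ∀ᶠ ω in aasFilter (lukModelMeasure ar p) atTop,
      ∀ s ∈ net, ∀ w, ∃ m, ω.2.extensionDiagram F w m ∈ Metric.ball s (δ / 2) :=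
    (eventually_all_finite hfinite).2 fun s _ => eventually_exists_extensionDiagram_mem p
      measurableSet_ball (Metric.measure_ball_pos _ s (half_pos hδ)).ne'
  filter_upwards [hrealized] with ω hω w t
  obtain ⟨s, hs, hts⟩ := Set.mem_iUnion₂.1 (hcover (Set.mem_univ t))
  obtain ⟨m, hm⟩ := hω s hs w
  refine ⟨m, fun a => (dist_le_pi_dist _ _ a).trans ?_⟩
  linarith [dist_triangle_right (ω.2.extensionDiagram F w m) t s, Metric.mem_ball.1 hm,
    Metric.mem_ball.1 hts]

end RandomStructures

section ConvergenceLaw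

variable {τ : Type*} {ar : τ → ℕ} {p : τ → Measure I} [∀ R, IsProbabilityMeasure (p R)]
  {φ : LukSentence ar}

theorem tendsto_lukProb_one_iff {V : Set I} (hV : MeasurableSet V) :
    Tendsto (fun n => lukProb p n φ V) atTop (𝓝 1) ↔
      ∀ᶠ ω in aasFilter (lukModelMeasure ar p) atTop, LukSentence.value φ ω.2 ∈ V :=
  Iff.symm <| eventually_aasFilter_iff_tendsto_one fun _ => φ.measurable_eval Fin.elim0 hV

theorem forall_pos_tendsto_lukProb_iff {a : I} :
    (∀ ε : ℝ, 0 < ε →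
      Tendsto (fun n : ℕ => lukProb p n φ {x | |(x : ℝ) - a| < ε}) atTop (𝓝 1)) ↔
      Tendsto (fun ω => LukSentence.value φ ω.2) (aasFilter (lukModelMeasure ar p) atTop)
        (𝓝 a) := by
  rw [Metric.nhds_basis_ball.tendsto_right_iff]
  exact forall₂_congr fun ε _ => tendsto_lukProb_one_iff (V := Metric.ball a ε) measurableSet_ball

theorem forall_ordConnected_tendsto_lukProb_iff {a : I} :
    (∀ V : Set I, IsOpen V → V.OrdConnected → a ∈ V →
      Tendsto (fun n : ℕ => lukProb p n φ V) atTop (𝓝 1)) ↔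
      Tendsto (fun ω => LukSentence.value φ ω.2) (aasFilter (lukModelMeasure ar p) atTop)
        (𝓝 a) := by
  refine ⟨fun h => forall_pos_tendsto_lukProb_iff.1 fun ε hε => ?_, fun h V hV _ haV => ?_⟩
  · exact h (Metric.ball a ε) Metric.isOpen_ball
      ((convex_ball (a : ℝ) ε).ordConnected.preimage_mono (Subtype.mono_coe _))
      (Metric.mem_ball_self hε)
  · exact (tendsto_lukProb_one_iff hV.measurableSet).2 (h.eventually (hV.mem_nhds haV))

theorem existsUnique_tendsto_value (har : ∀ R, 1 ≤ ar R) [∀ R, (p R).IsOpenPosMeasure] :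
    ∃! a, Tendsto (fun ω => LukSentence.value φ ω.2) (aasFilter (lukModelMeasure ar p) atTop)
      (𝓝 a) := by
  refine existsUnique_of_exists_of_unique ?_ fun _ _ => tendsto_nhds_unique
  refine cauchy_map_iff_exists_tendsto.1 (Metric.cauchy_iff.2 ⟨inferInstance, fun ε hε => ?_⟩)
  obtain ⟨δ, hδ, hδε⟩ := exists_pos_mul_lt hε φ.relCount
  refine ⟨_, image_mem_map (eventually_isGeneric p φ.finite_rels φ.depth hδ), ?_⟩
  rintro _ ⟨ω, hω, rfl⟩ _ ⟨ω', hω', rfl⟩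
  exact (LukSentence.dist_value_le har hδ.le φ hω hω').trans_lt hδε

end ConvergenceLaw

theorem mainTheorem2 {τ : Type*} (ar : τ → ℕ) (har : ∀ R, 1 ≤ ar R)
    (p : τ → Measure I) [∀ R, IsProbabilityMeasure (p R)]
    (hp : ∀ R, ∀ J : Set I, J.OrdConnected → J.Nontrivial → 0 < p R J)
    (φ : LukSentence ar) :
    (∃! a : I, ∀ V : Set I, IsOpen V → V.OrdConnected → a ∈ V →
      Tendsto (fun n : ℕ => lukProb p n φ V) atTop (𝓝 1)) ∧
    (∃! a : I, ∀ ε : ℝ, 0 < ε →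
      Tendsto (fun n : ℕ => lukProb p n φ {x | |(x : ℝ) - a| < ε}) atTop (𝓝 1)) ∧
    (∀ a : I,
      (∀ V : Set I, IsOpen V → V.OrdConnected → a ∈ V →
        Tendsto (fun n : ℕ => lukProb p n φ V) atTop (𝓝 1)) ↔
      (∀ ε : ℝ, 0 < ε →
        Tendsto (fun n : ℕ => lukProb p n φ {x | |(x : ℝ) - a| < ε}) atTop (𝓝 1))) := by
  have (R : τ) : (p R).IsOpenPosMeasure := isOpenPosMeasure_of_forall_ordConnected_pos (hp R)
  simp only [forall_ordConnected_tendsto_lukProb_iff, forall_pos_tendsto_lukProb_iff, implies_true,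
    and_true, and_self]
  exact existsUnique_tendsto_value har
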